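/- **Setting.** A multi-player mean-payoff game arena consists of a finite set $P$ of players with a leader $l\in P$ (the other players are the followers), a finite set $V$ of vertices with an initial vertex $v_0$, a map assigning to each vertex the player who controls it ($V_p$ is the set of vertices of $p$), a set $E\subseteq V\times V$ of edges such that every vertex has an outgoing edge, and rewards $r_p:E\to\mathbb Q$ for $p\in P$. A strategy of $p$ is a map $\sigma_p:V^*V_p\to V$ that always selects an outgoing edge; a profile $\overline\sigma=(\sigma_p)_{p\in P}$ defines a unique play $\pi_{\overline\sigma}$ from $v_0$. The raw payoff of $p$ on $\pi=v_0v_1\dots$ is $r_p(\pi)=\liminf_n\frac1n\sum_{i<n}r_p(v_i,v_{i+1})$. An incentive profile $\overline\gamma$ gives each follower $p$ a map $\overline\gamma_p$ from histories (nonempty finite sequences of vertices) to $\mathbb R_{\ge0}$, and $\overline\gamma_p(\pi)=\liminf_n\frac1n\sum_{i<n}\overline\gamma_p(v_0\dots v_i)\in[0,\infty]$. The overall payoff of a follower $p$ under $(\overline\sigma,\overline\gamma)$ is $r_p(\pi_{\overline\sigma})+\overline\gamma_p(\pi_{\overline\sigma})$. The pair $(\overline\sigma,\overline\gamma)$ is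 an *incentive strategy profile* (ISP) if no follower can increase his overall payoff by a unilateral change of his strategy. For $p\in P$ let $\mathcal G_p$ be the two-player mean-payoff game on the same arena in which $p$ maximises his raw payoff against the coalition of all other players, and let $r_p(v)$ be its value when started in $v$, i.e. the supremum over strategies of $p$ of the infimum over strategies of the coalition of the raw payoff of $p$. Call a memoryless map $V\to V$ choosing outgoing edges optimal in $\mathcal G_p$ if, from every vertex, $p$ secures at least the value by following it at the vertices in $V_p$ and the coalition holds $p$ down to at most the value by following it at the other vertices. A finite play (a finite path from $v_0$ along edges) is a *deviating history* of $\overline\sigma$ if it is not a prefix of $\pi_{\overline\sigma}$; its *deviator* is the last player who made a move on it different from the one prescribed by $\overline\sigma$. Let $r_{\max}$ be the largest reward of any player on any edge. The pair $(\overline\sigma,\overline\gamma)$ is a *perfectly-incentivised strategy profile* (PSP) if * for each follower $p$, $\overline\gamma_p$ is constant on the nonempty prefixes of $\pi_{\overline\sigma}$; the constant is also written $\overline\gamma_p$; * there are optimal memoryless maps $\tau_p$ in $\mathcal G_p$, $p\in P$, such that after every deviating history $h$ with deviator $p$ and last vertex $v$ the owner $p'$ of $v$ moves to $v'=\tau_p(v)$;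 and if moreover $p'$ is a follower and $p'\ne p$, then $r_{p'}(v,v')+\overline\gamma_{p'}(h\cdot v')=r_{\max}+1$; * apart from these exceptions, all incentives on deviating histories are $0$. The profile $\overline\sigma$ is *well-behaved* if the share of every edge $e\in E$ among the first $n$ steps of $\pi_{\overline\sigma}$ converges as $n\to\infty$. For a play $\pi$ let $Q$ be the set of vertices visited by $\pi$ and $S$ the set of vertices visited infinitely often. Given reals $\iota_p\ge0$ for the followers $p$, we say that $\pi$ *satisfies the constraint system with incentives $\iota$* if the limit frequencies $p_v$ ($v\in V$) and $p_e$ ($e\in E$) on $\pi$ exist and 1. $p_v=0$ for $v\in V\setminus S$ and $p_v\ge0$ for $v\in S$; 2. $p_e=0$ for $e\in E\setminus(S\times S)$ and $p_e\ge 0$ for $e\in E\cap(S\times S)$; 3. $\sum_{v\in V}p_v=1$; 4. $p_s=\sum_{(s,t)\in E}p_{(s,t)}$ for all $s\in S$, and $p_t=\sum_{(s,t)\in E}p_{(s,t)}$ for all $t\in S$; 5. $\iota_p+\sum_{e\in E}p_e\,r_p(e)\ge\max_{v\in Q}r_p(v)$ for every follower $p$. **Statement.** (a) If $(\overline\sigma,\overline\gamma)$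 is a PSP and an ISP and $\overline\sigma$ is well-behaved, then $\pi_{\overline\sigma}$ satisfies the constraint system with incentives $\iota_p=\overline\gamma_p$. (b) Let $(\overline\sigma,\overline\gamma)$ be any pair of a well-behaved profile and an incentive profile, not necessarily a PSP or an ISP, and suppose that $\pi_{\overline\sigma}$ satisfies the constraint system with some incentives $\iota_p\ge 0$ (for instance $\iota_p=\overline\gamma_p(\pi_{\overline\sigma})$, if these are finite). Then there is a PSP $(\overline\sigma',\overline\gamma')$ with $\pi_{\overline\sigma'}=\pi_{\overline\sigma}$ and $\overline\gamma'_p=\iota_p$ for all followers $p$, and every such PSP is an ISP. Moreover, every follower $p$ with $\iota_p=\overline\gamma_p(\pi_{\overline\sigma})$ has the same overall payoff under $(\overline\sigma',\overline\gamma')$ as under $(\overline\sigma,\overline\gamma)$. -/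

import Mathlib

open Filter Topology
open scoped NNReal

/-- A multi-player mean-payoff game arena with player set `P` and vertex set `V` (both will be
finite).  The partition of the vertices is given by the map sending a vertex to the player who
controls it.  Only the values of `reward p` on edges are ever used. -/
structure MMPGArena (P V : Type*) where
  leader : P
  init : V
  owner : V → P
  edges : Finset (V × V)
  exists_edge : ∀ v, ∃ w, (v, w) ∈ edges
  reward : P → V × V → ℚ

namespace MMPGArena

variable {P V : Type*}

/-- The players other than the leader. -/
abbrev Follower (G : MMPGArena P V) : Type _ := {p : P // p ≠ G.leader}

/-- A strategy of player `p`: a map `V* V_p → V` that always selects an outgoing edge.  A nonempty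
history `v₀ … vₙ` is represented by the list `[v₀, …, vₙ₋₁]` and the last vertex `vₙ`. -/
def Strategy (G : MMPGArena P V) (p : P) : Type _ :=
  {f : List V → {v : V // G.owner v = p} → V // ∀ h v, (v.1, f h v) ∈ G.edges}

/-- A strategy profile: one strategy for every player. -/
abbrev Profile (G : MMPGArena P V) : Type _ := (p : P) → G.Strategy p

/-- An incentive profile: one map from nonempty histories to nonnegative reals for every
follower. -/
abbrev IncentiveProfile (G : MMPGArena P V) : Type _ := G.Follower → List V → V → ℝ≥0

/-- The successor that the profile selects after the history `h · v`. -/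
def move (G : MMPGArena P V) (σ : G.Profile) (h : List V) (v : V) : V :=
  (σ (G.owner v)).1 h ⟨v, rfl⟩

/-- The history of length `n + 1` of the play of `σ` started in `v`. -/
def runFrom (G : MMPGArena P V) (σ : G.Profile) (v : V) : ℕ → List V × V
  | 0 => ([], v)
  | n + 1 => ((G.runFrom σ v n).1 ++ [(G.runFrom σ v n).2],
      G.move σ (G.runFrom σ v n).1 (G.runFrom σ v n).2)

/-- The infinite play of `σ` started in `v`. -/
def playFrom (G : MMPGArena P V) (σ : G.Profile) (v : V) (n : ℕ) : V := (G.runFrom σ v n).2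

/-- The infinite play `π_σ` of `σ`, started in the initial vertex. -/
def play (G : MMPGArena P V) (σ : G.Profile) : ℕ → V := G.playFrom σ G.init

/-- The list `[π 0, …, π (n - 1)]`; together with `π n` it is the prefix of length `n + 1`. -/
def before (π : ℕ → V) (n : ℕ) : List V := (List.range n).map π

theorem runFrom_fst (G : MMPGArena P V) (σ : G.Profile) (v : V) (n : ℕ) :
    (G.runFrom σ v n).1 = before (G.playFrom σ v) n := by
  induction n with
  | zero => rfl
  | succ n ih => simp [runFrom, before, List.range_succ, ih, playFrom]

theorem playFrom_succ (G : MMPGArena P V) (σ : G.Profile) (v : V) (n : ℕ) :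
    G.playFrom σ v (n + 1)
      = G.move σ (before (G.playFrom σ v) n) (G.playFrom σ v n) := by
  rw [← runFrom_fst]; rfl

/-- The limit average (limes inferior) of a sequence of reals, as an extended real. -/
noncomputable def limAvg (x : ℕ → ℝ) : EReal :=
  liminf (fun n : ℕ => (((∑ i ∈ Finset.range n, x i) / (n : ℝ) : ℝ) : EReal)) atTop

/-- The raw payoff `r_p(π)`. -/
noncomputable def rawPayoff (G : MMPGArena P V) (p : P) (π : ℕ → V) : EReal :=
  limAvg fun i => (G.reward p (π i, π (i + 1)) : ℝ)

/-- The incentive `ι_p(π)` that follower `p` receives on the play `π`; it may be infinite. -/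
noncomputable def meanIncentive (G : MMPGArena P V) (γ : G.IncentiveProfile) (p : G.Follower)
    (π : ℕ → V) : EReal :=
  limAvg fun i => (γ p (before π i) (π i) : ℝ)

/-- The overall payoff of follower `p`: raw payoff plus incentive. -/
noncomputable def followerPayoff (G : MMPGArena P V) (σ : G.Profile) (γ : G.IncentiveProfile)
    (p : G.Follower) : EReal :=
  G.rawPayoff p (G.play σ) + G.meanIncentive γ p (G.play σ)

/-- Incentive strategy profile (ISP): no follower can improve his overall payoff by a unilateral
deviation. -/
def IsISP [DecidableEq P] (G : MMPGArena P V) (σ : G.Profile) (γ : G.IncentiveProfile) : Prop :=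
  ∀ (p : G.Follower) (σ' : G.Strategy p),
    G.followerPayoff (Function.update σ p.1 σ') γ p ≤ G.followerPayoff σ γ p

/-- The value `r_p(v)` of the vertex `v` in the two-player mean-payoff game `𝒢_p`, in which `p`
maximises his raw payoff against the coalition of all other players. -/
noncomputable def value [DecidableEq P] (G : MMPGArena P V) (p : P) (v : V) : EReal :=
  ⨆ τ : G.Strategy p, ⨅ σ : G.Profile, G.rawPayoff p (G.playFrom (Function.update σ p τ) v)

/-- `τ` consists of optimal memoryless strategies of both sides in the two-player game `𝒢_p`:
from every vertex, `p` secures at least the value by following `τ` at his vertices, and the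
coalition of the other players holds him down to the value by following `τ` at theirs. -/
structure IsOptimalMemoryless [DecidableEq P] (G : MMPGArena P V) (p : P) (τ : V → V) : Prop where
  edge : ∀ v, (v, τ v) ∈ G.edges
  secures : ∀ π : ℕ → V, (∀ n, (π n, π (n + 1)) ∈ G.edges) →
    (∀ n, G.owner (π n) = p → π (n + 1) = τ (π n)) → G.value p (π 0) ≤ G.rawPayoff p π
  bounds : ∀ π : ℕ → V, (∀ n, (π n, π (n + 1)) ∈ G.edges) →
    (∀ n, G.owner (π n) ≠ p → π (n + 1) = τ (π n)) → G.rawPayoff p π ≤ G.value p (π 0)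

/-- `h · v` is a finite play of the arena. -/
inductive IsHistory (G : MMPGArena P V) : List V → V → Prop
  | start : G.IsHistory [] G.init
  | step {h : List V} {v w : V} : G.IsHistory h v → (v, w) ∈ G.edges → G.IsHistory (h ++ [v]) w

/-- A deviating history: a finite play that is not a prefix of `π_σ`. -/
def IsDeviating (G : MMPGArena P V) (σ : G.Profile) (h : List V) (v : V) : Prop :=
  G.IsHistory h v ∧ ∀ n, ¬ (h = before (G.play σ) n ∧ v = G.play σ n)

/-- `G.LastDeviator σ h v p` says that, on the finite play `h · v`, some player has deviated from
his strategy in `σ` and `p` is the last one who has done so, i.e. `p = dev(h · v, σ)`. -/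
inductive LastDeviator (G : MMPGArena P V) (σ : G.Profile) : List V → V → P → Prop
  | deviate {h : List V} {v w : V} : G.IsHistory h v → (v, w) ∈ G.edges → w ≠ G.move σ h v →
      G.LastDeviator σ (h ++ [v]) w (G.owner v)
  | comply {h : List V} {v : V} {p : P} : G.LastDeviator σ h v p →
      G.LastDeviator σ (h ++ [v]) (G.move σ h v) p

theorem edges_nonempty (G : MMPGArena P V) : G.edges.Nonempty :=
  let ⟨w, hw⟩ := G.exists_edge G.init
  ⟨(G.init, w), hw⟩

/-- The largest reward `r_max` of any player on any edge. -/
noncomputable def maxReward [Fintype P] (G : MMPGArena P V) : ℝ :=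
  ((Finset.univ ×ˢ G.edges).sup' (Finset.Nonempty.product ⟨G.leader, Finset.mem_univ _⟩
    G.edges_nonempty) fun x : P × (V × V) => G.reward x.1 x.2 : ℚ)

/-- `h · v` extends a deviating history with last deviator `p` by the move prescribed by `σ`, this
move was made by the follower `q`, and `q ≠ p`. -/
def RewardedAt (G : MMPGArena P V) (σ : G.Profile) (q : G.Follower) (h : List V) (v : V) : Prop :=
  ∃ (h' : List V) (u : V) (p : P), h = h' ++ [u] ∧ G.LastDeviator σ h' u p ∧ v = G.move σ h' u ∧
    G.owner u = q ∧ (q : P) ≠ p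

/-- Perfectly-incentivised strategy profile (PSP).  The family `τ` supplies the strategies from
the two-player games `𝒢_p`. -/
def IsPSP [DecidableEq P] [Fintype P] (G : MMPGArena P V) (σ : G.Profile)
    (γ : G.IncentiveProfile) : Prop :=
  ∃ τ : P → V → V, (∀ p, G.IsOptimalMemoryless p (τ p)) ∧
    (∀ (p : G.Follower) (m n : ℕ),
      γ p (before (G.play σ) m) (G.play σ m) = γ p (before (G.play σ) n) (G.play σ n)) ∧
    (∀ h v p, G.LastDeviator σ h v p → G.move σ h v = τ p v) ∧
    (∀ h v p (q : G.Follower), G.LastDeviator σ h v p → G.owner v = q → (q : P) ≠ p →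
      (G.reward q (v, τ p v) : ℝ) + γ q (h ++ [v]) (τ p v) = G.maxReward + 1) ∧
    (∀ h v (q : G.Follower), G.IsDeviating σ h v → ¬ G.RewardedAt σ q h v → γ q h v = 0)

/-- The incentive `γ_p` of a PSP, i.e. the constant value of `γ p` on the prefixes of the play. -/
def onPathIncentive (G : MMPGArena P V) (γ : G.IncentiveProfile) (p : G.Follower) : ℝ≥0 :=
  γ p [] G.init

/-- The share of the edge `e` among the first `n` steps of `π`. -/
noncomputable def edgeShare [DecidableEq V] (π : ℕ → V) (e : V × V) (n : ℕ) : ℝ :=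
  (((Finset.range n).filter fun i => (π i, π (i + 1)) = e).card : ℝ) / n

/-- The share of the vertex `v` among the first `n` positions of `π`. -/
noncomputable def vertexShare [DecidableEq V] (π : ℕ → V) (v : V) (n : ℕ) : ℝ :=
  (((Finset.range n).filter fun i => π i = v).card : ℝ) / n

/-- A profile is well-behaved if the frequency of every edge on its play has a limit. -/
def WellBehaved [DecidableEq V] (G : MMPGArena P V) (σ : G.Profile) : Prop :=
  ∀ e ∈ G.edges, ∃ x : ℝ, Tendsto (edgeShare (G.play σ) e) atTop (𝓝 x)

/-- The linear constraint system for a set `Q` of visited vertices and a set `S` of recurrent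
vertices, in the vertex ratios `pv`, the edge ratios `pe` and the incentives `ι`. -/
structure Constraints [DecidableEq P] [DecidableEq V] [Fintype V] (G : MMPGArena P V)
    (Q S : Set V) (pv : V → ℝ) (pe : V × V → ℝ) (ι : G.Follower → ℝ≥0) : Prop where
  vertex_zero : ∀ v, v ∉ S → pv v = 0
  vertex_nonneg : ∀ v ∈ S, 0 ≤ pv v
  edge_zero : ∀ e ∈ G.edges, ¬ (e.1 ∈ S ∧ e.2 ∈ S) → pe e = 0
  edge_nonneg : ∀ e ∈ G.edges, e.1 ∈ S ∧ e.2 ∈ S → 0 ≤ pe e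
  vertex_sum : ∑ v, pv v = 1
  outflow : ∀ s ∈ S, pv s = ∑ e ∈ G.edges with e.1 = s, pe e
  inflow : ∀ t ∈ S, pv t = ∑ e ∈ G.edges with e.2 = t, pe e
  incentive : ∀ p : G.Follower, (⨆ v ∈ Q, G.value p v) ≤
    (((ι p : ℝ) + ∑ e ∈ G.edges, pe e * (G.reward p e : ℝ) : ℝ) : EReal)

/-- The play `π`, together with the incentives `ι`, satisfies the constraint system: `Q` is the set
of vertices visited by `π`, `S` the set of those visited infinitely often, and the ratios are the
limit frequencies on `π`. -/
def PlaySatisfies [DecidableEq P] [DecidableEq V] [Fintype V] (G : MMPGArena P V) (π : ℕ → V)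
    (ι : G.Follower → ℝ≥0) : Prop :=
  ∃ (pv : V → ℝ) (pe : V × V → ℝ),
    (∀ v, Tendsto (vertexShare π v) atTop (𝓝 (pv v))) ∧
    (∀ e ∈ G.edges, Tendsto (edgeShare π e) atTop (𝓝 (pe e))) ∧
    G.Constraints (Set.range π) {v | ∃ᶠ n in atTop, π n = v} pv pe ι

end MMPGArena

/-! ### Positional determinacy of mean-payoff games -/

namespace MeanPayoff

variable {V : Type*}

/-! When edge frequencies converge, the raw payoff is linear in them, so on a PSP the inequality of
constraint 5 says that each follower gets at least his value at every visited vertex. All other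
constraints hold for any play with convergent edge frequencies, by counting
(`playSatisfies_of_incentive`).

This inequality is exactly stability. In an ISP it holds because a follower may keep to his strategy
until a given vertex of the play and then switch to his optimal memoryless strategy; raw payoffs
ignore finite prefixes and incentives are nonnegative (`IsISP.value_le`). Conversely, in a PSP a
follower who changes the play leaves it at one of his own vertices and stays the last deviator
forever. The others then play optimally against him, and he soon gets no more incentives, so he ends
up with at most his value at the vertex where he left (`IsPSP.followerPayoff_update_le`).

Existence of a PSP along a given play needs optimal memoryless maps (`exists_memoryless`).
Discounted games have them by a fixed-point argument; as the discount factor tends to 1, one of the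
finitely many maps is optimal infinitely often, and it stays optimal for the mean payoff. A profile
that remembers the last deviator then realises the punishments (`exists_isPSP`). -/

theorem abs_sup'_sub_sup'_le {ι : Type*} {s : Finset ι} (hs : s.Nonempty) {f g : ι → ℝ} {c : ℝ}
    (h : ∀ i ∈ s, |f i - g i| ≤ c) : |s.sup' hs f - s.sup' hs g| ≤ c := by
  have key : ∀ {f g : ι → ℝ}, (∀ i ∈ s, |f i - g i| ≤ c) → s.sup' hs f ≤ s.sup' hs g + c := by
    intro f g h
    refine Finset.sup'_le hs f fun i hi => ?_
    have := (abs_le.1 (h i hi)).2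
    have := Finset.le_sup' g hi
    linarith
  have h1 := key h
  have h2 := key (f := g) (g := f) fun i hi => by rw [abs_sub_comm]; exact h i hi
  exact abs_le.2 ⟨by linarith, by linarith⟩

theorem abs_inf'_sub_inf'_le {ι : Type*} {s : Finset ι} (hs : s.Nonempty) {f g : ι → ℝ} {c : ℝ}
    (h : ∀ i ∈ s, |f i - g i| ≤ c) : |s.inf' hs f - s.inf' hs g| ≤ c := by
  have key : ∀ {f g : ι → ℝ}, (∀ i ∈ s, |f i - g i| ≤ c) → s.inf' hs f - c ≤ s.inf' hs g := by
    intro f g h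
    refine Finset.le_inf' hs g fun i hi => ?_
    have := (abs_le.1 (h i hi)).2
    have := Finset.inf'_le f hi
    linarith
  have h1 := key h
  have h2 := key (f := g) (g := f) fun i hi => by rw [abs_sub_comm]; exact h i hi
  exact abs_le.2 ⟨by linarith, by linarith⟩

open Classical in
/-- The Shapley operator of a normalised discounted game: vertices in `M` maximise, the others
minimise. -/
noncomputable def shapley (M : V → Prop) (E : V → Finset V) (hE : ∀ u, (E u).Nonempty)
    (r : V → V → ℝ) (β : ℝ) (g : V → ℝ) (u : V) : ℝ :=
  if M u then (E u).sup' (hE u) fun w => (1 - β) * r u w + β * g w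
  else (E u).inf' (hE u) fun w => (1 - β) * r u w + β * g w

theorem abs_shapley_sub_le {M : V → Prop} {E : V → Finset V} {hE : ∀ u, (E u).Nonempty}
    {r : V → V → ℝ} {β c : ℝ} (h0 : 0 ≤ β) {g g' : V → ℝ} (h : ∀ w, |g w - g' w| ≤ c) (u : V) :
    |shapley M E hE r β g u - shapley M E hE r β g' u| ≤ β * c := by
  have hw : ∀ w ∈ E u, |((1 - β) * r u w + β * g w) - ((1 - β) * r u w + β * g' w)| ≤ β * c := by
    intro w _
    rw [add_sub_add_left_eq_sub, ← mul_sub, abs_mul, abs_of_nonneg h0]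
    exact mul_le_mul_of_nonneg_left (h w) h0
  unfold shapley
  split_ifs
  · exact abs_sup'_sub_sup'_le _ hw
  · exact abs_inf'_sub_inf'_le _ hw

/-- The operator contracts the sup norm by the factor `β`. -/
theorem exists_shapley_fixedPoint [Fintype V] (M : V → Prop) (E : V → Finset V)
    (hE : ∀ u, (E u).Nonempty) (r : V → V → ℝ) {β : ℝ} (h0 : 0 ≤ β) (h1 : β < 1) :
    ∃ g : V → ℝ, shapley M E hE r β g = g := by
  have hc : ContractingWith ⟨β, h0⟩ (shapley M E hE r β) := by
    refine ⟨h1, LipschitzWith.of_dist_le_mul fun g g' => ?_⟩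
    refine (dist_pi_le_iff (by positivity)).2 fun u => ?_
    exact abs_shapley_sub_le h0 (fun w => dist_le_pi_dist g g' w) u
  exact ⟨_, hc.fixedPoint_isFixedPt⟩

/-- `g` is the vector of values of the normalised `β`-discounted game and `τ` is a memoryless map
that is optimal in it for both sides. -/
structure DiscountedSolution (M : V → Prop) (E : V → Finset V) (r : V → V → ℝ) (β : ℝ)
    (g : V → ℝ) (τ : V → V) : Prop where
  mem : ∀ u, τ u ∈ E u
  eq : ∀ u, g u = (1 - β) * r u (τ u) + β * g (τ u)
  maximal : ∀ u, M u → ∀ w ∈ E u, (1 - β) * r u w + β * g w ≤ g u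
  minimal : ∀ u, ¬ M u → ∀ w ∈ E u, g u ≤ (1 - β) * r u w + β * g w

theorem exists_discountedSolution [Fintype V] (M : V → Prop) (E : V → Finset V)
    (hE : ∀ u, (E u).Nonempty) (r : V → V → ℝ) {β : ℝ} (h0 : 0 ≤ β) (h1 : β < 1) :
    ∃ g τ, DiscountedSolution M E r β g τ := by
  obtain ⟨g, hg⟩ := exists_shapley_fixedPoint M E hE r h0 h1
  have hτ : ∀ u, ∃ w ∈ E u, g u = (1 - β) * r u w + β * g w := by
    intro u
    have hu := congrFun hg u
    unfold shapley at hu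
    split_ifs at hu
    · obtain ⟨w, hw, he⟩ := Finset.exists_mem_eq_sup' (hE u) fun w => (1 - β) * r u w + β * g w
      exact ⟨w, hw, by rw [← he, hu]⟩
    · obtain ⟨w, hw, he⟩ := Finset.exists_mem_eq_inf' (hE u) fun w => (1 - β) * r u w + β * g w
      exact ⟨w, hw, by rw [← he, hu]⟩
  choose τ hτE hτ using hτ
  refine ⟨g, τ, hτE, hτ, fun u hu w hw => ?_, fun u hu w hw => ?_⟩
  · have h := congrFun hg u
    rw [shapley, if_pos hu] at h
    rw [← h]
    exact Finset.le_sup' (fun w => (1 - β) * r u w + β * g w) hw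
  · have h := congrFun hg u
    rw [shapley, if_neg hu] at h
    rw [← h]
    exact Finset.inf'_le (fun w => (1 - β) * r u w + β * g w) hw

/-- The factor `1 - β` on rewards makes the bound independent of `β`, so the values stay in a
compact ball as `β` tends to 1. -/
theorem DiscountedSolution.norm_le [Fintype V] {M : V → Prop} {E : V → Finset V} {r : V → V → ℝ}
    {β : ℝ} {g : V → ℝ} {τ : V → V} (h : DiscountedSolution M E r β g τ) (h0 : 0 ≤ β) (h1 : β < 1)
    {C : ℝ} (hC0 : 0 ≤ C) (hC : ∀ u w, |r u w| ≤ C) : ‖g‖ ≤ C := by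
  have hb : ‖g‖ ≤ (1 - β) * C + β * ‖g‖ := by
    have h1' : 0 ≤ 1 - β := by linarith
    refine (pi_norm_le_iff_of_nonneg (by positivity)).2 fun u => ?_
    rw [h.eq u, Real.norm_eq_abs]
    refine (abs_add_le _ _).trans (add_le_add ?_ ?_)
    · rw [abs_mul, abs_of_nonneg h1']
      exact mul_le_mul_of_nonneg_left (hC _ _) h1'
    · rw [abs_mul, abs_of_nonneg h0]
      exact mul_le_mul_of_nonneg_left (norm_le_pi_norm g (τ u)) h0
  by_contra! hlt
  nlinarith

/-- If the discounted values `g k` tend to `g` as `β k` tends to `1`, then a path along which the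
discounted values satisfy the subharmonic inequality has asymptotic average at least the limit
value of its first vertex. -/
theorem eventually_le_average {r : V → V → ℝ} {β : ℕ → ℝ} (hβ1 : ∀ k, β k < 1)
    (hβ : Tendsto β atTop (𝓝 1)) {g : ℕ → V → ℝ} {g' : V → ℝ} {C : ℝ} (hC : ∀ k u, |g k u| ≤ C)
    [Finite V] (hg : ∀ u, Tendsto (fun k => g k u) atTop (𝓝 (g' u))) {π : ℕ → V}
    (hπ : ∀ k n, g k (π n) ≤ (1 - β k) * r (π n) (π (n + 1)) + β k * g k (π (n + 1)))
    {ε : ℝ} (hε : 0 < ε) :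
    ∀ᶠ n : ℕ in atTop, g' (π 0) - ε ≤ (∑ i ∈ Finset.range n, r (π i) (π (i + 1))) / (n : ℝ) := by
  -- In the limit `β k → 1` the reward term disappears: limit values never decrease along the path.
  have hmono : ∀ n, g' (π 0) ≤ g' (π n) := by
    intro n
    induction n with
    | zero => exact le_rfl
    | succ n ih =>
      refine ih.trans ?_
      have hlim : Tendsto (fun k => (1 - β k) * r (π n) (π (n + 1)) + β k * g k (π (n + 1))) atTop
          (𝓝 ((1 - 1) * r (π n) (π (n + 1)) + 1 * g' (π (n + 1)))) :=
        ((tendsto_const_nhds.sub hβ).mul_const _).add (hβ.mul (hg _))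
      simpa using le_of_tendsto_of_tendsto' (hg (π n)) hlim fun k => hπ k n
  have hclose : ∀ᶠ k in atTop, ∀ u, g' u - ε / 2 < g k u :=
    eventually_all.2 fun u => (hg u).eventually_const_lt (by linarith)
  obtain ⟨k, hk⟩ := hclose.exists
  have hpos : 0 < 1 - β k := by linarith [hβ1 k]
  -- Telescoping for one fixed `k`, after writing `β k = 1 - (1 - β k)` and bounding `g k (π (n +
  -- 1))` below by `g' (π 0) - ε / 2`.
  have hsum : ∀ n : ℕ, g k (π 0) - g k (π n) + (1 - β k) * (n * (g' (π 0) - ε / 2))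
      ≤ (1 - β k) * ∑ i ∈ Finset.range n, r (π i) (π (i + 1)) := by
    intro n
    induction n with
    | zero => simp
    | succ n ih =>
      rw [Finset.sum_range_succ, mul_add]
      have h1 := hπ k n
      have h2 : (1 - β k) * (g' (π 0) - ε / 2) ≤ (1 - β k) * g k (π (n + 1)) :=
        mul_le_mul_of_nonneg_left (by linarith [hk (π (n + 1)), hmono (n + 1)]) hpos.le
      push_cast
      linarith
  -- From here on the remaining slack `(1 - β k) * n * (ε / 2)` absorbs the boundary terms, which
  -- are at most `2 * C`.
  have hev : ∀ᶠ n : ℕ in atTop, 2 * C / ((1 - β k) * (ε / 2)) ≤ (n : ℝ) :=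
    tendsto_natCast_atTop_atTop.eventually_ge_atTop _
  filter_upwards [hev, eventually_gt_atTop 0] with n hn hn0
  have hn0' : (0 : ℝ) < n := by exact_mod_cast hn0
  rw [div_le_iff₀ (by positivity)] at hn
  rw [le_div_iff₀ hn0']
  have h1 := abs_le.1 (hC k (π 0))
  have h2 := abs_le.1 (hC k (π n))
  refine le_of_mul_le_mul_left ?_ hpos
  linarith [hsum n]

/-- Positional determinacy of mean-payoff games on finite graphs. -/
theorem exists_memoryless [Fintype V] (M : V → Prop) (E : V → Finset V)
    (hE : ∀ u, (E u).Nonempty) (r : V → V → ℝ) :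
    ∃ (g : V → ℝ) (τ : V → V), (∀ u, τ u ∈ E u) ∧
      (∀ π : ℕ → V, (∀ n, π (n + 1) ∈ E (π n)) → (∀ n, M (π n) → π (n + 1) = τ (π n)) →
        ∀ ε > 0, ∀ᶠ n : ℕ in atTop,
          g (π 0) - ε ≤ (∑ i ∈ Finset.range n, r (π i) (π (i + 1))) / (n : ℝ)) ∧
      (∀ π : ℕ → V, (∀ n, π (n + 1) ∈ E (π n)) → (∀ n, ¬ M (π n) → π (n + 1) = τ (π n)) →
        ∀ ε > 0, ∀ᶠ n : ℕ in atTop,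
          (∑ i ∈ Finset.range n, r (π i) (π (i + 1))) / (n : ℝ) ≤ g (π 0) + ε) := by
  classical
  obtain ⟨C, hC0, hC⟩ : ∃ C : ℝ, 0 ≤ C ∧ ∀ u w, |r u w| ≤ C := by
    refine ⟨∑ u, ∑ w, |r u w|, by positivity, fun u w => ?_⟩
    exact (Finset.single_le_sum (f := fun w => |r u w|) (fun _ _ => abs_nonneg _)
      (Finset.mem_univ w)).trans (Finset.single_le_sum (f := fun u => ∑ w, |r u w|)
        (fun _ _ => by positivity) (Finset.mem_univ u))
  let β : ℕ → ℝ := fun k => 1 - 1 / ((k : ℝ) + 1)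
  have hβ0 : ∀ k, 0 ≤ β k := fun k => by
    have : 1 / ((k : ℝ) + 1) ≤ 1 := by
      rw [div_le_one (by positivity)]
      linarith [Nat.cast_nonneg (α := ℝ) k]
    simp only [β]; linarith
  have hβ1 : ∀ k, β k < 1 := fun k => by
    have : 0 < 1 / ((k : ℝ) + 1) := by positivity
    simp only [β]; linarith
  have hβ : Tendsto β atTop (𝓝 1) := by
    simpa [β] using (tendsto_const_nhds (x := (1 : ℝ))).sub
      (tendsto_one_div_add_atTop_nhds_zero_nat (𝕜 := ℝ))
  choose g τ hsol using fun k => exists_discountedSolution M E hE r (hβ0 k) (hβ1 k)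
  -- There are only finitely many maps `V → V`, so one recurs infinitely often.
  obtain ⟨τ', hτ'⟩ : ∃ τ', ∃ᶠ k in atTop, τ k = τ' := by
    by_contra! hno
    have : ∀ᶠ k in atTop, ∀ τ', ¬ τ k = τ' := eventually_all.2 hno
    obtain ⟨k, hk⟩ := this.exists
    exact hk _ rfl
  obtain ⟨φ, hφ, hφτ⟩ := extraction_of_frequently_atTop hτ'
  have hnorm : ∀ k, ‖g k‖ ≤ C := fun k => (hsol k).norm_le (hβ0 k) (hβ1 k) hC0 hC
  obtain ⟨g', -, ψ, hψ, hlim⟩ := (isCompact_closedBall (0 : V → ℝ) C).tendsto_subseq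
    (x := fun k => g (φ k)) fun k => by simpa using hnorm (φ k)
  have hlim' : ∀ u, Tendsto (fun k => g (φ (ψ k)) u) atTop (𝓝 (g' u)) := tendsto_pi_nhds.1 hlim
  have hβ' : Tendsto (fun k => β (φ (ψ k))) atTop (𝓝 1) :=
    hβ.comp (hφ.tendsto_atTop.comp hψ.tendsto_atTop)
  have hbd : ∀ k u, |g (φ (ψ k)) u| ≤ C := fun k u => (norm_le_pi_norm _ u).trans (hnorm _)
  have hsol' : ∀ k, DiscountedSolution M E r (β (φ (ψ k))) (g (φ (ψ k))) τ' := fun k => by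
    simpa only [hφτ] using hsol (φ (ψ k))
  refine ⟨g', τ', (hsol' 0).mem, fun π hπ hM ε hε => ?_, fun π hπ hM ε hε => ?_⟩
  · refine eventually_le_average (fun k => hβ1 _) hβ' hbd hlim' (fun k n => ?_) hε
    by_cases h : M (π n)
    · rw [hM n h]
      exact ((hsol' k).eq _).le
    · exact (hsol' k).minimal _ h _ (hπ n)
  -- The minimiser's side is the same estimate for negated rewards and values.
  · have := eventually_le_average (r := fun u w => - r u w) (g := fun k u => - g (φ (ψ k)) u)
      (g' := fun u => - g' u) (C := C) (π := π) (fun k => hβ1 _) hβ'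
      (fun k u => by rw [abs_neg]; exact hbd k u) (fun u => (hlim' u).neg) (fun k n => ?_) hε
    · filter_upwards [this] with n hn
      rw [Finset.sum_neg_distrib, neg_div] at hn
      linarith
    · by_cases h : M (π n)
      · linarith [(hsol' k).maximal _ h _ (hπ n)]
      · rw [hM n h]
        linarith [(hsol' k).eq (π n)]

end MeanPayoff

/-! ### Limit averages and their independence of finite prefixes -/

namespace MMPGArena

variable {P V : Type*}

theorem limAvg_eq_of_tendsto {x : ℕ → ℝ} {a : ℝ}
    (h : Tendsto (fun n : ℕ => (∑ i ∈ Finset.range n, x i) / (n : ℝ)) atTop (𝓝 a)) :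
    limAvg x = a :=
  ((continuous_coe_real_ereal.tendsto a).comp h).liminf_eq

theorem le_limAvg {x : ℕ → ℝ} {a : ℝ}
    (h : ∀ ε > 0, ∀ᶠ n : ℕ in atTop, a - ε ≤ (∑ i ∈ Finset.range n, x i) / (n : ℝ)) :
    (a : EReal) ≤ limAvg x := by
  refine EReal.ge_of_forall_gt_iff_ge.1 fun z hz => ?_
  have hz' : z < a := by exact_mod_cast hz
  refine le_liminf_of_le (by isBoundedDefault) ?_
  filter_upwards [h (a - z) (by linarith)] with n hn
  exact_mod_cast (by linarith : z ≤ _)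

theorem limAvg_le {x : ℕ → ℝ} {a : ℝ}
    (h : ∀ ε > 0, ∀ᶠ n : ℕ in atTop, (∑ i ∈ Finset.range n, x i) / (n : ℝ) ≤ a + ε) :
    limAvg x ≤ (a : EReal) := by
  refine EReal.le_of_forall_lt_iff_le.1 fun z hz => ?_
  have hz' : a < z := by exact_mod_cast hz
  refine liminf_le_of_frequently_le' (Eventually.frequently ?_)
  filter_upwards [h (z - a) (by linarith)] with n hn
  exact_mod_cast (by linarith : _ ≤ z)

theorem limAvg_const (a : ℝ) : limAvg (fun _ => a) = a := by
  refine limAvg_eq_of_tendsto (tendsto_const_nhds.congr' ?_)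
  filter_upwards [eventually_gt_atTop 0] with n hn
  have : (n : ℝ) ≠ 0 := by positivity
  simp [this]

theorem limAvg_nonneg {x : ℕ → ℝ} (h : ∀ i, 0 ≤ x i) : 0 ≤ limAvg x := by
  refine le_liminf_of_le (by isBoundedDefault) (Eventually.of_forall fun n => ?_)
  exact_mod_cast div_nonneg (Finset.sum_nonneg fun i _ => h i) (Nat.cast_nonneg n)

theorem limAvg_eq_zero {x : ℕ → ℝ} {N : ℕ} (h : ∀ i, N ≤ i → x i = 0) : limAvg x = 0 := by
  rw [← EReal.coe_zero]
  refine limAvg_eq_of_tendsto ?_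
  refine (tendsto_const_div_atTop_nhds_zero_nat (∑ i ∈ Finset.range N, x i)).congr' ?_
  filter_upwards [eventually_ge_atTop N] with n hn
  congr 1
  refine Finset.sum_subset (Finset.range_subset_range.2 hn) fun i _ hi => h i ?_
  simpa using hi

/-- Superadditivity of liminf; working in `EReal` avoids any boundedness assumption. -/
theorem liminf_coe_le_of_tendsto_sub {a b : ℕ → ℝ}
    (h : Tendsto (fun n => b n - a n) atTop (𝓝 0)) :
    liminf (fun n => (a n : EReal)) atTop ≤ liminf (fun n => (b n : EReal)) atTop := by
  have h0 : liminf (fun n => ((b n - a n : ℝ) : EReal)) atTop = 0 :=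
    ((continuous_coe_real_ereal.tendsto 0).comp h).liminf_eq
  have := EReal.le_liminf_add (f := atTop) (u := fun n => (a n : EReal))
    (v := fun n => ((b n - a n : ℝ) : EReal))
  rw [h0, add_zero] at this
  refine this.trans_eq (congrArg (fun f => liminf f atTop) (funext fun n => ?_))
  rw [Pi.add_apply, ← EReal.coe_add, add_sub_cancel]

theorem limAvg_shift {x : ℕ → ℝ} {C : ℝ} (hC : ∀ i, |x i| ≤ C) (m : ℕ) :
    limAvg (fun i => x (m + i)) = limAvg x := by
  have hdiff : Tendsto (fun n : ℕ => (∑ i ∈ Finset.range n, x (m + i)) / (n : ℝ) -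
      (∑ i ∈ Finset.range (n + m), x i) / ((n + m : ℕ) : ℝ)) atTop (𝓝 0) := by
    have hb : Tendsto (fun n : ℕ => (m * C + |∑ i ∈ Finset.range m, x i|) / (n : ℝ)) atTop (𝓝 0) :=
      tendsto_const_div_atTop_nhds_zero_nat _
    refine squeeze_zero_norm' ?_ hb
    filter_upwards [eventually_gt_atTop 0] with n hn
    have hn0 : (0 : ℝ) < n := by exact_mod_cast hn
    have hm0 : (0 : ℝ) ≤ m := Nat.cast_nonneg m
    have hsum : ∑ i ∈ Finset.range (n + m), x i
        = (∑ i ∈ Finset.range m, x i) + ∑ i ∈ Finset.range n, x (m + i) := by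
      rw [add_comm n m, Finset.sum_range_add]
    have hT : |∑ i ∈ Finset.range n, x (m + i)| ≤ n * C := by
      refine (Finset.abs_sum_le_sum_abs _ _).trans ?_
      refine (Finset.sum_le_sum fun i _ => hC (m + i)).trans ?_
      simp
    rw [hsum]
    set T := ∑ i ∈ Finset.range n, x (m + i)
    set S := ∑ i ∈ Finset.range m, x i
    -- The numerator stays bounded because `x` is, so the difference is of order `1 / n`.
    have he : T / (n : ℝ) - (S + T) / ((n + m : ℕ) : ℝ) = (m * (T / n) - S) / (n + m) := by
      push_cast
      field_simp
      ring
    have hT' : |T / n| ≤ C := by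
      rw [abs_div, abs_of_pos hn0, div_le_iff₀ hn0]
      linarith
    rw [he, Real.norm_eq_abs, abs_div, abs_of_pos (by positivity : (0 : ℝ) < n + m)]
    have hnum : |m * (T / n) - S| ≤ m * C + |S| := by
      refine (abs_sub _ _).trans (add_le_add_left ?_ _)
      rw [abs_mul, abs_of_nonneg hm0]
      exact mul_le_mul_of_nonneg_left hT' hm0
    exact (div_le_div_of_nonneg_right hnum (by positivity)).trans
      (div_le_div_of_nonneg_left ((abs_nonneg _).trans hnum) hn0 (by linarith))
  have hadd := liminf_nat_add
    (fun n : ℕ => (((∑ i ∈ Finset.range n, x i) / (n : ℝ) : ℝ) : EReal)) m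
  unfold limAvg
  rw [← hadd]
  refine le_antisymm (liminf_coe_le_of_tendsto_sub ?_) (liminf_coe_le_of_tendsto_sub hdiff)
  simpa using hdiff.neg

theorem abs_reward_le [Fintype V] (G : MMPGArena P V) (p : P) :
    ∃ C : ℝ, ∀ e, |(G.reward p e : ℝ)| ≤ C :=
  ⟨∑ e, |(G.reward p e : ℝ)|, fun e =>
    Finset.single_le_sum (f := fun e => |(G.reward p e : ℝ)|) (fun _ _ => abs_nonneg _)
      (Finset.mem_univ e)⟩

theorem rawPayoff_shift [Fintype V] (G : MMPGArena P V) (p : P) (π : ℕ → V) (m : ℕ) :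
    G.rawPayoff p (fun i => π (m + i)) = G.rawPayoff p π := by
  obtain ⟨C, hC⟩ := G.abs_reward_le p
  exact limAvg_shift (x := fun i => (G.reward p (π i, π (i + 1)) : ℝ)) (fun i => hC _) m

/-! ### Plays, updated profiles and optimal memoryless maps -/

theorem move_mem_edges (G : MMPGArena P V) (σ : G.Profile) (h : List V) (v : V) :
    (v, G.move σ h v) ∈ G.edges :=
  (σ (G.owner v)).2 h ⟨v, rfl⟩

theorem playFrom_mem_edges (G : MMPGArena P V) (σ : G.Profile) (v : V) (n : ℕ) :
    (G.playFrom σ v n, G.playFrom σ v (n + 1)) ∈ G.edges := by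
  rw [playFrom_succ]
  exact G.move_mem_edges σ _ _

theorem play_succ (G : MMPGArena P V) (σ : G.Profile) (n : ℕ) :
    G.play σ (n + 1) = G.move σ (before (G.play σ) n) (G.play σ n) :=
  G.playFrom_succ σ G.init n

theorem play_mem_edges (G : MMPGArena P V) (σ : G.Profile) (n : ℕ) :
    (G.play σ n, G.play σ (n + 1)) ∈ G.edges :=
  G.playFrom_mem_edges σ G.init n

theorem before_succ (π : ℕ → V) (n : ℕ) : before π (n + 1) = before π n ++ [π n] := by
  simp [before, List.range_succ]

theorem before_congr {π ρ : ℕ → V} {n : ℕ} (h : ∀ i < n, π i = ρ i) : before π n = before ρ n := by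
  simpa [before] using h

theorem length_before (π : ℕ → V) (n : ℕ) : (before π n).length = n := by simp [before]

section Update

variable [DecidableEq P]

theorem move_update_of_eq (G : MMPGArena P V) (σ : G.Profile) {p : P} (s : G.Strategy p)
    (h : List V) {v : V} (hv : G.owner v = p) :
    G.move (Function.update σ p s) h v = s.1 h ⟨v, hv⟩ := by
  subst hv
  simp [move]

theorem move_update_of_ne (G : MMPGArena P V) (σ : G.Profile) {p : P} (s : G.Strategy p)
    (h : List V) {v : V} (hv : G.owner v ≠ p) :
    G.move (Function.update σ p s) h v = G.move σ h v := by
  simp [move, Function.update_of_ne hv]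

end Update

/-- The strategy of `p` that follows the memoryless map `τ`. -/
def memoryless (G : MMPGArena P V) {τ : V → V} (hτ : ∀ v, (v, τ v) ∈ G.edges) (p : P) :
    G.Strategy p :=
  ⟨fun _ v => τ v.1, fun _ v => hτ v.1⟩

/-- The value is a supremum of infima over strategies with memory. The coalition's memoryless answer
bounds every infimum by `g`, and the player's own memoryless strategy attains `g`, so the value is
the number `g` of `MeanPayoff.exists_memoryless`. -/
theorem exists_isOptimalMemoryless [DecidableEq P] [Fintype V] [DecidableEq V]
    (G : MMPGArena P V) (p : P) : ∃ τ, G.IsOptimalMemoryless p τ := by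
  obtain ⟨g, τ, hτ, hsec, hbd⟩ := MeanPayoff.exists_memoryless (fun v => G.owner v = p)
    (fun v => Finset.univ.filter fun w => (v, w) ∈ G.edges)
    (fun v => (G.exists_edge v).imp fun w hw => by simpa using hw)
    (fun v w => (G.reward p (v, w) : ℝ))
  simp only [Finset.mem_filter, Finset.mem_univ, true_and] at hτ hsec hbd
  have hsec' : ∀ π : ℕ → V, (∀ n, (π n, π (n + 1)) ∈ G.edges) →
      (∀ n, G.owner (π n) = p → π (n + 1) = τ (π n)) → (g (π 0) : EReal) ≤ G.rawPayoff p π :=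
    fun π hπ hp => le_limAvg (hsec π hπ hp)
  have hbd' : ∀ π : ℕ → V, (∀ n, (π n, π (n + 1)) ∈ G.edges) →
      (∀ n, G.owner (π n) ≠ p → π (n + 1) = τ (π n)) → G.rawPayoff p π ≤ (g (π 0) : EReal) :=
    fun π hπ hp => limAvg_le (hbd π hπ hp)
  have hval : ∀ v, G.value p v = g v := by
    intro v
    refine le_antisymm (iSup_le fun s => ?_) ?_
    · refine (iInf_le _ (fun q => G.memoryless hτ q)).trans ?_
      refine hbd' _ (G.playFrom_mem_edges _ v) fun n hn => ?_
      rw [playFrom_succ, move_update_of_ne _ _ _ _ hn]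
      rfl
    · refine le_trans (le_iInf fun σ => ?_) (le_iSup (fun s : G.Strategy p =>
        ⨅ σ : G.Profile, G.rawPayoff p (G.playFrom (Function.update σ p s) v)) (G.memoryless hτ p))
      refine hsec' _ (G.playFrom_mem_edges _ v) fun n hn => ?_
      rw [playFrom_succ, move_update_of_eq _ _ _ _ hn]
      rfl
  exact ⟨τ, hτ, fun π hπ hp => by rw [hval]; exact hsec' π hπ hp,
    fun π hπ hp => by rw [hval]; exact hbd' π hπ hp⟩

/-! ### Edge and vertex frequencies -/

section Frequencies

variable [DecidableEq V]

theorem sum_range_eq_sum_edges (G : MMPGArena P V) {π : ℕ → V}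
    (hπ : ∀ n, (π n, π (n + 1)) ∈ G.edges) (f : V × V → ℝ) (n : ℕ) :
    (∑ i ∈ Finset.range n, f (π i, π (i + 1))) / (n : ℝ)
      = ∑ e ∈ G.edges, edgeShare π e n * f e := by
  rw [← Finset.sum_fiberwise_of_maps_to (g := fun i => (π i, π (i + 1))) (t := G.edges)
    (fun i _ => hπ i), Finset.sum_div]
  refine Finset.sum_congr rfl fun e _ => ?_
  rw [edgeShare, Finset.sum_congr rfl (g := fun _ => f e) fun i hi => by
    rw [(Finset.mem_filter.1 hi).2], Finset.sum_const, nsmul_eq_mul]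
  ring

theorem vertexShare_eq_sum (π : ℕ → V) (v : V) (n : ℕ) :
    vertexShare π v n = (∑ i ∈ Finset.range n, if π i = v then (1 : ℝ) else 0) / (n : ℝ) := by
  simp [vertexShare]

theorem vertexShare_eq_outflow (G : MMPGArena P V) {π : ℕ → V}
    (hπ : ∀ n, (π n, π (n + 1)) ∈ G.edges) (v : V) (n : ℕ) :
    vertexShare π v n = ∑ e ∈ G.edges with e.1 = v, edgeShare π e n := by
  rw [vertexShare_eq_sum, G.sum_range_eq_sum_edges hπ (fun e => if e.1 = v then (1 : ℝ) else 0),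
    Finset.sum_filter]
  simp

/-- Entering `v` at step `i` means being there at position `i + 1`, so the difference of the counts
telescopes. -/
theorem inflow_sub_vertexShare (G : MMPGArena P V) {π : ℕ → V}
    (hπ : ∀ n, (π n, π (n + 1)) ∈ G.edges) (v : V) (n : ℕ) :
    (∑ e ∈ G.edges with e.2 = v, edgeShare π e n) - vertexShare π v n
      = ((if π n = v then (1 : ℝ) else 0) - if π 0 = v then (1 : ℝ) else 0) / (n : ℝ) := by
  have h := G.sum_range_eq_sum_edges hπ (fun e => if e.2 = v then (1 : ℝ) else 0) n
  rw [Finset.sum_filter, vertexShare_eq_sum]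
  simp only [mul_ite, mul_one, mul_zero] at h
  rw [← h, ← sub_div, ← Finset.sum_sub_distrib,
    Finset.sum_range_sub (fun i => if π i = v then (1 : ℝ) else 0)]

theorem tendsto_inflow_sub_vertexShare (G : MMPGArena P V) {π : ℕ → V}
    (hπ : ∀ n, (π n, π (n + 1)) ∈ G.edges) (v : V) :
    Tendsto (fun n => (∑ e ∈ G.edges with e.2 = v, edgeShare π e n) - vertexShare π v n)
      atTop (𝓝 0) := by
  refine squeeze_zero_norm (fun n => ?_) (tendsto_const_div_atTop_nhds_zero_nat (1 : ℝ))
  rw [G.inflow_sub_vertexShare hπ, norm_div, Real.norm_natCast]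
  refine div_le_div_of_nonneg_right ?_ (Nat.cast_nonneg n)
  split_ifs <;> simp

theorem tendsto_vertexShare_zero {π : ℕ → V} {v : V} (h : ¬ ∃ᶠ n in atTop, π n = v) :
    Tendsto (vertexShare π v) atTop (𝓝 0) := by
  obtain ⟨N, hN⟩ := eventually_atTop.1 (not_frequently.1 h)
  refine squeeze_zero (fun n => by unfold vertexShare; positivity) (fun n => ?_)
    (tendsto_const_div_atTop_nhds_zero_nat (N : ℝ))
  refine div_le_div_of_nonneg_right ?_ (Nat.cast_nonneg n)
  have : ((Finset.range n).filter fun i => π i = v) ⊆ Finset.range N := fun i hi => by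
    by_contra hiN
    exact hN i (by simpa using hiN) (Finset.mem_filter.1 hi).2
  exact_mod_cast (Finset.card_le_card this).trans_eq (Finset.card_range N)

theorem sum_vertexShare [Fintype V] (π : ℕ → V) {n : ℕ} (hn : 0 < n) :
    ∑ v, vertexShare π v n = 1 := by
  have hn' : (n : ℝ) ≠ 0 := by positivity
  simp only [vertexShare]
  rw [← Finset.sum_div, ← Nat.cast_sum, ← Finset.card_eq_sum_card_fiberwise (by simp),
    Finset.card_range, div_self hn']

theorem rawPayoff_eq_of_tendsto (G : MMPGArena P V) {π : ℕ → V}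
    (hπ : ∀ n, (π n, π (n + 1)) ∈ G.edges) {pe : V × V → ℝ}
    (hpe : ∀ e ∈ G.edges, Tendsto (edgeShare π e) atTop (𝓝 (pe e))) (p : P) :
    G.rawPayoff p π = ((∑ e ∈ G.edges, pe e * (G.reward p e : ℝ) : ℝ) : EReal) := by
  refine limAvg_eq_of_tendsto ?_
  simp only [G.sum_range_eq_sum_edges hπ fun e => (G.reward p e : ℝ)]
  exact tendsto_finsetSum _ fun e he => (hpe e he).mul_const _

/-- A play with limit edge frequencies satisfies the constraint system as soon as it satisfies its
incentive part. -/
theorem playSatisfies_of_incentive [DecidableEq P] [Fintype V] (G : MMPGArena P V) {π : ℕ → V}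
    (hπ : ∀ n, (π n, π (n + 1)) ∈ G.edges) {pe : V × V → ℝ}
    (hpe : ∀ e ∈ G.edges, Tendsto (edgeShare π e) atTop (𝓝 (pe e))) {ι : G.Follower → ℝ≥0}
    (hι : ∀ p : G.Follower, (⨆ v ∈ Set.range π, G.value p v) ≤
      (((ι p : ℝ) + ∑ e ∈ G.edges, pe e * (G.reward p e : ℝ) : ℝ) : EReal)) :
    G.PlaySatisfies π ι := by
  set pv : V → ℝ := fun v => ∑ e ∈ G.edges with e.1 = v, pe e with hpv_def
  have hpv : ∀ v, Tendsto (vertexShare π v) atTop (𝓝 (pv v)) := fun v => by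
    rw [funext (G.vertexShare_eq_outflow hπ v)]
    exact tendsto_finsetSum _ fun e he => hpe e (Finset.mem_filter.1 he).1
  have hin : ∀ v, pv v = ∑ e ∈ G.edges with e.2 = v, pe e := fun v => by
    have h1 : Tendsto (fun n => ∑ e ∈ G.edges with e.2 = v, edgeShare π e n) atTop
        (𝓝 (∑ e ∈ G.edges with e.2 = v, pe e)) :=
      tendsto_finsetSum _ fun e he => hpe e (Finset.mem_filter.1 he).1
    have h2 := tendsto_nhds_unique (h1.sub (hpv v)) (G.tendsto_inflow_sub_vertexShare hπ v)
    linarith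
  have hnn : ∀ e ∈ G.edges, 0 ≤ pe e := fun e he =>
    ge_of_tendsto' (hpe e he) fun n => by unfold edgeShare; positivity
  have hz : ∀ v, ¬ (∃ᶠ n in atTop, π n = v) → pv v = 0 := fun v hv =>
    tendsto_nhds_unique (hpv v) (tendsto_vertexShare_zero hv)
  refine ⟨pv, pe, hpv, hpe, hz, fun v _ => ?_, fun e he hS => ?_, fun e he _ => hnn e he, ?_,
    fun _ _ => rfl, fun v _ => hin v, hι⟩
  · exact Finset.sum_nonneg fun e he => hnn e (Finset.mem_filter.1 he).1
  -- An edge is no more frequent than either endpoint: outflow handles the source, inflow the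
  -- target.
  · refine le_antisymm ?_ (hnn e he)
    rcases not_and_or.1 hS with h | h
    · rw [← hz e.1 h]
      exact Finset.single_le_sum (f := pe) (fun e he => hnn e (Finset.mem_filter.1 he).1)
        (Finset.mem_filter.2 ⟨he, rfl⟩)
    · rw [← hz e.2 h, hin]
      exact Finset.single_le_sum (f := pe) (fun e he => hnn e (Finset.mem_filter.1 he).1)
        (Finset.mem_filter.2 ⟨he, rfl⟩)
  · refine tendsto_nhds_unique (tendsto_finsetSum _ fun v _ => hpv v)
      (tendsto_const_nhds.congr' ?_)
    filter_upwards [eventually_gt_atTop 0] with n hn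
    exact (sum_vertexShare π hn).symm

end Frequencies

theorem meanIncentive_eq_onPathIncentive (G : MMPGArena P V) {σ : G.Profile}
    {γ : G.IncentiveProfile} {p : G.Follower}
    (h : ∀ m n : ℕ, γ p (before (G.play σ) m) (G.play σ m) = γ p (before (G.play σ) n) (G.play σ n)) :
    G.meanIncentive γ p (G.play σ) = ((G.onPathIncentive γ p : ℝ) : EReal) := by
  have : ∀ i, γ p (before (G.play σ) i) (G.play σ i) = G.onPathIncentive γ p := fun i => h i 0
  simp only [meanIncentive, this, limAvg_const]

/-! ### Payoffs in an ISP are at least the values on the play -/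

section Deviation

variable [DecidableEq P]

/-- The strategy that follows `s` up to step `m` and the memoryless map `τ` from then on. -/
def switchTo (G : MMPGArena P V) {p : P} (s : G.Strategy p) (m : ℕ) {τ : V → V}
    (hτ : ∀ v, (v, τ v) ∈ G.edges) : G.Strategy p :=
  ⟨fun h v => if h.length < m then s.1 h v else τ v.1, fun h v => by
    dsimp only
    split_ifs
    · exact s.2 h v
    · exact hτ v.1⟩

/-- Position `m` is still included: it is reached by a move after a history with fewer than `m`
earlier vertices. -/
theorem play_update_switchTo (G : MMPGArena P V) (σ : G.Profile) (p : P) (m : ℕ) {τ : V → V}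
    (hτ : ∀ v, (v, τ v) ∈ G.edges) {n : ℕ} (hn : n ≤ m) :
    G.play (Function.update σ p (G.switchTo (σ p) m hτ)) n = G.play σ n := by
  induction n using Nat.strong_induction_on with
  | _ n ih =>
    cases n with
    | zero => rfl
    | succ n =>
      rw [play_succ, play_succ, ih n (Nat.lt_succ_self n) (by omega),
        before_congr fun i hi => ih i (by omega) (by omega)]
      by_cases ho : G.owner (G.play σ n) = p
      · rw [move_update_of_eq _ _ _ _ ho]
        subst ho
        simp only [switchTo, length_before, if_pos (show n < m by omega)]
        rfl
      · rw [move_update_of_ne _ _ _ _ ho]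

/-- In an ISP no follower gets less than his value at a vertex of the play. -/
theorem IsISP.value_le [Fintype V] {G : MMPGArena P V} {σ : G.Profile} {γ : G.IncentiveProfile}
    (h : G.IsISP σ γ) (p : G.Follower) {τ : V → V} (hτ : G.IsOptimalMemoryless p τ) (m : ℕ) :
    G.value p (G.play σ m) ≤ G.followerPayoff σ γ p := by
  set σ' := Function.update σ p.1 (G.switchTo (σ p.1) m hτ.edge) with hσ'
  -- Optimality is applied to the tail from position `m`, where the switched strategy is memoryless.
  have hsec := hτ.secures (fun i => G.play σ' (m + i)) (fun n => G.play_mem_edges σ' (m + n))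
    fun n hn => by
      change G.play σ' (m + n + 1) = _
      rw [play_succ, hσ', move_update_of_eq _ _ _ _ hn]
      simp only [switchTo, length_before, if_neg (show ¬ m + n < m by omega)]
      rfl
  rw [G.rawPayoff_shift, add_zero, hσ', G.play_update_switchTo σ p m hτ.edge le_rfl] at hsec
  refine (hsec.trans ?_).trans (h p (G.switchTo (σ p.1) m hτ.edge))
  exact le_add_of_nonneg_right (limAvg_nonneg fun i => NNReal.coe_nonneg _)

end Deviation

/-! ### Deviating histories and the last deviator -/

theorem isHistory_play (G : MMPGArena P V) (σ : G.Profile) (n : ℕ) :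
    G.IsHistory (before (G.play σ) n) (G.play σ n) := by
  induction n with
  | zero => exact .start
  | succ n ih =>
    rw [before_succ]
    exact .step ih (G.play_mem_edges σ n)

namespace LastDeviator

variable {G : MMPGArena P V} {σ : G.Profile} {h : List V} {v : V} {p : P}

theorem isHistory (hd : G.LastDeviator σ h v p) : G.IsHistory h v := by
  induction hd with
  | deviate hh he _ => exact .step hh he
  | comply _ ih => exact .step ih (G.move_mem_edges σ _ _)

/-- A deviating move leaves the play if it had been followed so far, and no extension of a
non-prefix is a prefix. -/
theorem not_prefix (hd : G.LastDeviator σ h v p) (n : ℕ) :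
    ¬ (h = before (G.play σ) n ∧ v = G.play σ n) := by
  induction hd generalizing n with
  | deviate hh he hne =>
    rintro ⟨hb, rfl⟩
    cases n with
    | zero => simp [before] at hb
    | succ n =>
      rw [before_succ] at hb
      obtain ⟨rfl, hv⟩ := List.append_inj' hb rfl
      obtain rfl := List.singleton_injective hv
      exact hne (G.play_succ σ n)
  | comply _ ih =>
    rintro ⟨hb, -⟩
    cases n with
    | zero => simp [before] at hb
    | succ n =>
      rw [before_succ] at hb
      obtain ⟨rfl, hv⟩ := List.append_inj' hb rfl
      exact ih n ⟨rfl, List.singleton_injective hv⟩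

theorem isDeviating (hd : G.LastDeviator σ h v p) : G.IsDeviating σ h v :=
  ⟨hd.isHistory, hd.not_prefix⟩

theorem deviated_or_complied {u : V} (hd : G.LastDeviator σ (h ++ [u]) v p) :
    (v ≠ G.move σ h u ∧ p = G.owner u) ∨ (v = G.move σ h u ∧ G.LastDeviator σ h u p) := by
  generalize hl : h ++ [u] = l at hd
  cases hd with
  | deviate hh he hne =>
    obtain ⟨rfl, hv⟩ := List.append_inj' hl rfl
    obtain rfl := List.singleton_injective hv
    exact .inl ⟨hne, rfl⟩
  | comply hd =>
    obtain ⟨rfl, hv⟩ := List.append_inj' hl rfl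
    obtain rfl := List.singleton_injective hv
    exact .inr ⟨rfl, hd⟩

theorem unique {q : P} (hp : G.LastDeviator σ h v p)
    (hq : G.LastDeviator σ h v q) : p = q := by
  induction hp with
  | deviate hh he hne =>
    rcases hq.deviated_or_complied with h' | h'
    · exact h'.2.symm
    · exact absurd h'.1 hne
  | comply hd ih =>
    rcases hq.deviated_or_complied with h' | h'
    · exact absurd rfl h'.1
    · exact ih h'.2

end LastDeviator

/-- A play that results from a unilateral deviation of `p` and differs from `π_σ` leaves `π_σ` at a
vertex of `p`, and from then on `p` is the last deviator. -/
theorem exists_lastDeviator_of_play_ne [DecidableEq P] [DecidableEq V] (G : MMPGArena P V)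
    (σ : G.Profile) {p : P} (s : G.Strategy p)
    (hne : G.play (Function.update σ p s) ≠ G.play σ) :
    ∃ n, G.play (Function.update σ p s) n = G.play σ n ∧ G.owner (G.play σ n) = p ∧
      ∀ j, n < j → G.LastDeviator σ (before (G.play (Function.update σ p s)) j)
        (G.play (Function.update σ p s) j) p := by
  set ρ := G.play (Function.update σ p s) with hρ
  obtain ⟨k, hk, hmin⟩ : ∃ k, ρ k ≠ G.play σ k ∧ ∀ i < k, ρ i = G.play σ i := by
    have hex := Function.ne_iff.1 hne
    exact ⟨Nat.find hex, Nat.find_spec hex, fun i hi => not_not.1 (Nat.find_min hex hi)⟩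
  -- Both plays start in the initial vertex, so the first difference has a predecessor.
  obtain _ | n := k
  · exact absurd rfl hk
  have hn : ρ n = G.play σ n := hmin n (Nat.lt_succ_self n)
  have hb : before ρ n = before (G.play σ) n := before_congr fun i hi => hmin i (by omega)
  -- Everyone but `p` still follows `σ`, so every departure from `σ` along `ρ`, first or later, is
  -- made by `p`.
  have hsucc : ∀ j, ρ (j + 1) ≠ G.move σ (before ρ j) (ρ j) → G.owner (ρ j) = p := by
    intro j hj
    by_contra ho
    exact hj (by rw [hρ, play_succ, move_update_of_ne _ _ _ _ ho])
  have hmove : ρ (n + 1) ≠ G.move σ (before ρ n) (ρ n) := by rwa [hb, hn, ← play_succ]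
  have hdev : ∀ j, ρ (j + 1) ≠ G.move σ (before ρ j) (ρ j) →
      G.LastDeviator σ (before ρ (j + 1)) (ρ (j + 1)) p := by
    intro j hj
    rw [before_succ]
    have := LastDeviator.deviate (G.isHistory_play _ j) (G.play_mem_edges _ j) hj
    rwa [← hρ, hsucc j hj] at this
  refine ⟨n, hn, hn ▸ hsucc n hmove, fun j hj => ?_⟩
  induction j, hj using Nat.le_induction with
  | base => exact hdev n hmove
  | succ j _ ih =>
    by_cases hj : ρ (j + 1) = G.move σ (before ρ j) (ρ j)
    · rw [before_succ, hj]
      exact .comply ih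
    · exact hdev j hj

/-! ### Deviations from a PSP do not pay -/

theorem IsPSP.meanIncentive_eq [DecidableEq P] [Fintype P] {G : MMPGArena P V} {σ : G.Profile}
    {γ : G.IncentiveProfile} (h : G.IsPSP σ γ) (p : G.Follower) :
    G.meanIncentive γ p (G.play σ) = ((G.onPathIncentive γ p : ℝ) : EReal) := by
  obtain ⟨_, -, hc, -⟩ := h
  exact G.meanIncentive_eq_onPathIncentive (hc p)

/-- In a PSP a follower who changes the play gets at most his value at some vertex of the original
play. -/
theorem IsPSP.followerPayoff_update_le [DecidableEq P] [Fintype P] [Fintype V] [DecidableEq V]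
    {G : MMPGArena P V} {σ : G.Profile} {γ : G.IncentiveProfile} (h : G.IsPSP σ γ)
    (p : G.Follower) (s : G.Strategy p) (hne : G.play (Function.update σ p.1 s) ≠ G.play σ) :
    ∃ n, G.followerPayoff (Function.update σ p.1 s) γ p ≤ G.value p (G.play σ n) := by
  obtain ⟨τ, hopt, -, hmove, -, hzero⟩ := h
  obtain ⟨n, hn, ho, hdev⟩ := G.exists_lastDeviator_of_play_ne σ s hne
  refine ⟨n, ?_⟩
  rw [followerPayoff]
  set ρ := G.play (Function.update σ p.1 s) with hρ
  have hinc : G.meanIncentive γ p ρ = 0 := by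
    -- Rewards depend on the deviator one step earlier, who is known to be `p` only after position
    -- `n`; hence `n + 2`.
    refine limAvg_eq_zero (N := n + 2) fun j hj => ?_
    obtain ⟨j, rfl⟩ : ∃ i, j = i + 1 := ⟨j - 1, by omega⟩
    rw [hzero _ _ _ (hdev (j + 1) (by omega)).isDeviating, NNReal.coe_zero]
    rintro ⟨h', u, q, hb, hq, -, -, hqp⟩
    rw [before_succ] at hb
    obtain ⟨rfl, hv⟩ := List.append_inj' hb rfl
    obtain rfl := List.singleton_injective hv
    exact hqp ((hdev j (by omega)).unique hq)
  -- The play is cut at position `n`, not `n + 1`: the vertex there belongs to `p`, so the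
  -- coalition's condition is void at that step.
  have hb := (hopt p).bounds (fun i => ρ (n + i)) (fun i => G.play_mem_edges _ (n + i))
    fun i hi => by
      have hi0 : i ≠ 0 := by
        rintro rfl
        exact hi (by simpa [hn] using ho)
      rw [← hmove _ _ _ (hdev (n + i) (by omega))]
      change ρ (n + i + 1) = _
      rw [hρ, play_succ, move_update_of_ne _ _ _ _ hi]
  rw [G.rawPayoff_shift, add_zero, hn] at hb
  rwa [hinc, add_zero]

theorem IsPSP.isISP [DecidableEq P] [Fintype P] [Fintype V] [DecidableEq V]
    {G : MMPGArena P V} {σ : G.Profile} {γ : G.IncentiveProfile} (h : G.IsPSP σ γ)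
    (hs : G.PlaySatisfies (G.play σ) (G.onPathIncentive γ)) : G.IsISP σ γ := by
  obtain ⟨pv, pe, -, hpe, hcon⟩ := hs
  intro p s
  by_cases hne : G.play (Function.update σ p.1 s) = G.play σ
  · rw [followerPayoff, hne, followerPayoff]
  obtain ⟨n, hn⟩ := h.followerPayoff_update_le p s hne
  refine hn.trans ((le_iSup₂ (f := fun v (_ : v ∈ Set.range (G.play σ)) => G.value p v) _
    ⟨n, rfl⟩).trans ((hcon.incentive p).trans_eq ?_))
  rw [followerPayoff, h.meanIncentive_eq,
    G.rawPayoff_eq_of_tendsto (G.play_mem_edges σ) hpe, add_comm, EReal.coe_add]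

/-! ### Construction of a PSP along a given play -/

section Tracking

variable [DecidableEq V]

/-- The move planned at `v` after `n` earlier vertices: along `π` if nobody has deviated so far,
and by `τ p` if `p` is the last deviator. -/
def plannedMove (G : MMPGArena P V) (π : ℕ → V) (τ : P → V → V) (n : ℕ) (v : V) : Option P → V
  -- The fallback only keeps the move legal on lists that are not prefixes of `π`; the choice of the
  -- leader is arbitrary.
  | none => if (v, π (n + 1)) ∈ G.edges then π (n + 1) else τ G.leader v
  | some p => τ p v

/-- The last player who has deviated from the planned moves on the finite play that consists of
the reverse of the given list and the given last vertex. -/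
def trackDeviator (G : MMPGArena P V) (π : ℕ → V) (τ : P → V → V) : List V → V → Option P
  | [], _ => none
  | u :: h, v =>
    if v = G.plannedMove π τ h.length u (trackDeviator G π τ h u) then trackDeviator G π τ h u
    else some (G.owner u)

theorem plannedMove_mem_edges (G : MMPGArena P V) (π : ℕ → V) {τ : P → V → V}
    (hτ : ∀ p v, (v, τ p v) ∈ G.edges) (n : ℕ) (v : V) (o : Option P) :
    (v, G.plannedMove π τ n v o) ∈ G.edges := by
  cases o with
  | none =>
    unfold plannedMove
    split_ifs with h
    · exact h
    · exact hτ _ _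
  | some p => exact hτ p v

/-- The profile that follows `π` and answers deviations of `p` with `τ p`. -/
def trackingProfile (G : MMPGArena P V) (π : ℕ → V) {τ : P → V → V}
    (hτ : ∀ p v, (v, τ p v) ∈ G.edges) : G.Profile := fun _ =>
  ⟨fun h v => G.plannedMove π τ h.length v (G.trackDeviator π τ h.reverse v),
    fun _ _ => G.plannedMove_mem_edges π hτ _ _ _⟩

theorem move_trackingProfile (G : MMPGArena P V) (π : ℕ → V) {τ : P → V → V}
    (hτ : ∀ p v, (v, τ p v) ∈ G.edges) (h : List V) (v : V) :
    G.move (G.trackingProfile π hτ) h v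
      = G.plannedMove π τ h.length v (G.trackDeviator π τ h.reverse v) := rfl

/-- This resolves a circularity: the deviator is defined relative to a profile that must react to
him. `trackDeviator` refers only to planned moves and agrees with the deviator afterwards. -/
theorem LastDeviator.trackDeviator_eq {G : MMPGArena P V} {π : ℕ → V} {τ : P → V → V}
    {hτ : ∀ p v, (v, τ p v) ∈ G.edges} {h : List V} {v : V} {p : P}
    (hd : G.LastDeviator (G.trackingProfile π hτ) h v p) :
    G.trackDeviator π τ h.reverse v = some p := by
  induction hd with
  | deviate hh he hne =>
    rw [move_trackingProfile] at hne
    simp [trackDeviator, hne]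
  | comply _ ih => simp [trackDeviator, move_trackingProfile, ih]

theorem trackDeviator_before (G : MMPGArena P V) {π : ℕ → V}
    (hπ : ∀ n, (π n, π (n + 1)) ∈ G.edges) (τ : P → V → V) (n : ℕ) :
    G.trackDeviator π τ (before π n).reverse (π n) = none := by
  induction n with
  | zero => rfl
  | succ n ih => simp [before_succ, trackDeviator, ih, plannedMove, length_before, hπ n]

theorem play_trackingProfile (G : MMPGArena P V) {π : ℕ → V} (h0 : π 0 = G.init)
    (hπ : ∀ n, (π n, π (n + 1)) ∈ G.edges) {τ : P → V → V}
    (hτ : ∀ p v, (v, τ p v) ∈ G.edges) : G.play (G.trackingProfile π hτ) = π := by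
  funext n
  induction n using Nat.strong_induction_on with
  | _ n ih =>
    cases n with
    | zero => exact h0.symm
    | succ n =>
      rw [play_succ, ih n (Nat.lt_succ_self n), before_congr fun i hi => ih i (by omega),
        move_trackingProfile, G.trackDeviator_before hπ, length_before, plannedMove, if_pos (hπ n)]

end Tracking

theorem reward_le_maxReward [Fintype P] (G : MMPGArena P V) (p : P) {e : V × V}
    (he : e ∈ G.edges) : (G.reward p e : ℝ) ≤ G.maxReward := by
  unfold maxReward
  exact_mod_cast Finset.le_sup' (fun x : P × (V × V) => G.reward x.1 x.2)
    (Finset.mem_product.2 ⟨Finset.mem_univ p, he⟩ : (p, e) ∈ Finset.univ ×ˢ G.edges)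

open Classical in
/-- The incentives of a PSP with profile `σ` and constant incentives `ι` along its play. -/
noncomputable def pspIncentive [Fintype P] (G : MMPGArena P V) (σ : G.Profile)
    (ι : G.Follower → ℝ≥0) : G.IncentiveProfile := fun q h v =>
  if ∃ n, h = before (G.play σ) n ∧ v = G.play σ n then ι q
  else if G.RewardedAt σ q h v then
    Real.toNNReal (G.maxReward + 1 - G.reward q (h.getLastD v, v))
  else 0

theorem exists_isPSP [DecidableEq P] [Fintype P] [Fintype V] [DecidableEq V]
    (G : MMPGArena P V) (σ : G.Profile) (ι : G.Follower → ℝ≥0) :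
    ∃ (σ' : G.Profile) (γ' : G.IncentiveProfile),
      G.IsPSP σ' γ' ∧ G.play σ' = G.play σ ∧ G.onPathIncentive γ' = ι := by
  choose τ hτ using G.exists_isOptimalMemoryless
  have hedge : ∀ p v, (v, τ p v) ∈ G.edges := fun p => (hτ p).edge
  set σ' := G.trackingProfile (G.play σ) hedge with hσ'
  have hon : ∀ q n, G.pspIncentive σ' ι q (before (G.play σ') n) (G.play σ' n) = ι q :=
    fun q n => if_pos ⟨n, rfl, rfl⟩
  have hmove : ∀ h v p, G.LastDeviator σ' h v p → G.move σ' h v = τ p v := fun h v p hd => by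
    rw [hσ', move_trackingProfile, hd.trackDeviator_eq, plannedMove]
  refine ⟨σ', G.pspIncentive σ' ι, ⟨τ, hτ, fun q m n => by rw [hon, hon], hmove, ?_, ?_⟩,
    G.play_trackingProfile rfl (G.play_mem_edges σ) hedge, funext fun q => hon q 0⟩
  · intro h v p q hd ho hqp
    have hd' := LastDeviator.comply hd
    rw [hmove h v p hd] at hd'
    have hr : G.RewardedAt σ' q (h ++ [v]) (τ p v) :=
      ⟨h, v, p, rfl, hd, (hmove h v p hd).symm, ho, hqp⟩
    -- `Real.toNNReal` truncates nothing, as no reward on an edge exceeds `G.maxReward`; `getLastD`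
    -- returns `v`, the source of the rewarded edge.
    rw [pspIncentive, if_neg (not_exists.2 hd'.not_prefix), if_pos hr, Real.coe_toNNReal]
    · simp
    · have := G.reward_le_maxReward q (hedge p v)
      simp
      linarith
  · intro h v q hd hr
    rw [pspIncentive, if_neg (not_exists.2 hd.2), if_neg hr]

end MMPGArena

/-! ### The main theorem -/

theorem mainTheorem6 {P V : Type*} [Fintype P] [DecidableEq P] [Fintype V] [DecidableEq V]
    (G : MMPGArena P V) :
    (∀ (σ : G.Profile) (γ : G.IncentiveProfile),
      G.WellBehaved σ → G.IsPSP σ γ → G.IsISP σ γ →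
        G.PlaySatisfies (G.play σ) (G.onPathIncentive γ)) ∧
    (∀ (σ : G.Profile) (γ : G.IncentiveProfile) (ι : G.Follower → ℝ≥0),
      G.WellBehaved σ → G.PlaySatisfies (G.play σ) ι →
        (∃ (σ' : G.Profile) (γ' : G.IncentiveProfile),
          G.IsPSP σ' γ' ∧ G.play σ' = G.play σ ∧ G.onPathIncentive γ' = ι) ∧
        (∀ (σ' : G.Profile) (γ' : G.IncentiveProfile),
          G.IsPSP σ' γ' → G.play σ' = G.play σ → G.onPathIncentive γ' = ι →
            G.IsISP σ' γ' ∧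
            ∀ p : G.Follower, G.meanIncentive γ p (G.play σ) = ((ι p : ℝ) : EReal) →
              G.followerPayoff σ' γ' p = G.followerPayoff σ γ p)) := by
  refine ⟨fun σ γ hwb hpsp hisp => ?_, fun σ γ ι _ hs => ⟨G.exists_isPSP σ ι, ?_⟩⟩
  · choose! pe hpe using hwb
    refine G.playSatisfies_of_incentive (G.play_mem_edges σ) hpe fun p => ?_
    obtain ⟨τ, hτ, -⟩ := id hpsp
    refine iSup₂_le fun v hv => ?_
    obtain ⟨n, rfl⟩ := hv
    refine (hisp.value_le p (hτ p) n).trans_eq ?_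
    rw [MMPGArena.followerPayoff, hpsp.meanIncentive_eq,
      G.rawPayoff_eq_of_tendsto (G.play_mem_edges σ) hpe, add_comm, EReal.coe_add]
  · rintro σ' γ' hpsp hplay rfl
    refine ⟨hpsp.isISP (hplay ▸ hs), fun p hp => ?_⟩
    rw [MMPGArena.followerPayoff, MMPGArena.followerPayoff, hpsp.meanIncentive_eq, hplay, hp]
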